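/- Let $m,n\ge 0$. The lattice crossing $L(m,n)$ is the diagram in a rectangle formed by $n$ parallel vertical segments placed above $m$ parallel horizontal segments; it has $n$ endpoints on each of the top and bottom sides and $m$ endpoints on each of the left and right sides. A Catalan state $C$ of $L(m,n)$ is a family of $m+n$ pairwise disjoint arcs embedded in the rectangle that join these $2(m+n)$ boundary points in pairs, considered up to isotopy fixing the boundary. A Kauffman state $s$ of $L(m,n)$ assigns to each of the $mn$ crossings a positive or a negative marker; a crossing with a positive marker is smoothed so that its upper end is joined to its right end and its lower end to its left end, and a crossing with a negative marker so that its upper end is joined to its left end and its lower end to its right end. Let $D_s$ be the resulting crossingless diagram, $|D_s|$ the number of its closed components, $C_s$ the Catalan state obtained from $D_s$ by deleting its closed components, and $p(s)$, $n(s)$ the numbers of positive and negative markers of $s$. The coefficient of a Catalan state $C$ in $L(m,n)$ is the Laurent polynomial $$C(A)=\sum_{s\,:\,C_s=C} A^{p(s)-n(s)}\,\bigl(-A^{2}-A^{-2}\bigr)^{|D_s|}\in\mathbb{Z}[A,A^{-1}].$$ Then, for all $m,n\ge 0$ and every Catalan state $C$ of $L(m,n)$, every coefficient of $C(A)$ is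 a non-negative integer. -/

import Mathlib

namespace LatticeCrossing

/-- The marked points on the boundary of a rectangle with `h` points on its left side, `h` on its
right side, `a` on its top side and `b` on its bottom side.  The points of the top and bottom sides
are indexed from left to right, those of the left and right sides from top to bottom. -/
inductive BoundaryPoint (h a b : ℕ) : Type
  | top (j : Fin a)
  | right (i : Fin h)
  | bottom (j : Fin b)
  | left (i : Fin h)

/-- The place of a marked point when the boundary is traversed once, clockwise, starting from the
upper left corner. -/
def BoundaryPoint.position {h a b : ℕ} : BoundaryPoint h a b → ℕ
  | .top j => j
  | .right i => a + i
  | .bottom j => a + h + (Fin.rev j : Fin b)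
  | .left i => a + h + b + (Fin.rev i : Fin h)

/-- A crossingless connection, up to isotopy of the rectangle fixing its boundary: a perfect
matching of the marked points by disjoint arcs.  `partner x` is the other end of the arc that starts
at `x`; disjoint arcs can be drawn exactly if no two matched pairs interleave on the boundary. -/
structure CrossinglessConnection (h a b : ℕ) where
  partner : BoundaryPoint h a b → BoundaryPoint h a b
  partner_partner : ∀ x, partner (partner x) = x
  partner_ne : ∀ x, partner x ≠ x
  noncrossing : ∀ x y, ¬ (x.position < y.position ∧ y.position < (partner x).position ∧
    (partner x).position < (partner y).position)

/-- `Cat(m,n)`: the Catalan states of the lattice crossing `L(m,n)`. -/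
abbrev CatalanState (m n : ℕ) := CrossinglessConnection m n n

/-- A Kauffman state of `L(m,n)`: the choice of a marker at the crossing of the `i`-th horizontal
line (from the top) with the `j`-th vertical line (from the left), for all `i` and `j`; `true` is
the positive marker and `false` the negative one. -/
abbrev KauffmanState (m n : ℕ) := Fin m → Fin n → Bool

/-- The segments into which the crossings cut the lines of `L(m,n)`.  The `j`-th vertical line
consists of `vert 0 j, …, vert m j` from top to bottom, the `i`-th horizontal line of
`horiz i 0, …, horiz i n` from left to right.  So around the crossing `(i, j)` one finds
`vert i.castSucc j` above, `vert i.succ j` below, `horiz i j.castSucc` on the left and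
`horiz i j.succ` on the right. -/
inductive Segment (m n : ℕ) : Type
  | vert (i : Fin (m + 1)) (j : Fin n)
  | horiz (i : Fin m) (j : Fin (n + 1))

/-- The segment of `L(m,n)` that ends at a given boundary point. -/
def endSegment {m n : ℕ} : BoundaryPoint m n n → Segment m n
  | .top j => .vert 0 j
  | .right i => .horiz i (Fin.last n)
  | .bottom j => .vert (Fin.last m) j
  | .left i => .horiz i 0

/-- The pairs of segments that are joined when all crossings are smoothed as `s` prescribes.  As the
vertical lines run above the horizontal ones, a positive marker (the smoothing with coefficient `A`
in the Kauffman bracket) opens the channel between the upper left and the lower right region, that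
is, joins top with right and bottom with left; a negative marker joins top with left and bottom
with right. -/
inductive Joined {m n : ℕ} (s : KauffmanState m n) : Segment m n → Segment m n → Prop
  | posTopRight (i : Fin m) (j : Fin n) (hs : s i j = true) :
      Joined s (.vert i.castSucc j) (.horiz i j.succ)
  | posBottomLeft (i : Fin m) (j : Fin n) (hs : s i j = true) :
      Joined s (.vert i.succ j) (.horiz i j.castSucc)
  | negTopLeft (i : Fin m) (j : Fin n) (hs : s i j = false) :
      Joined s (.vert i.castSucc j) (.horiz i j.castSucc)
  | negBottomRight (i : Fin m) (j : Fin n) (hs : s i j = false) :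
      Joined s (.vert i.succ j) (.horiz i j.succ)

/-- The components of the smoothed diagram `D_s`: the classes of the equivalence relation generated
by `Joined s`. -/
abbrev Component {m n : ℕ} (s : KauffmanState m n) : Type := Quot (Joined s)

/-- The component of `D_s` that ends at a given boundary point. -/
def componentAt {m n : ℕ} (s : KauffmanState m n) (x : BoundaryPoint m n n) : Component s :=
  Quot.mk _ (endSegment x)

/-- `|D_s|`: the number of closed components of `D_s`, those that reach no boundary point. -/
noncomputable def closedCount {m n : ℕ} (s : KauffmanState m n) : ℕ :=
  Nat.card {c : Component s // ∀ x : BoundaryPoint m n n, componentAt s x ≠ c}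

/-- `C_s = C`: after its closed components are removed, `D_s` joins the same pairs of boundary
points as `C`. -/
def Realizes {m n : ℕ} (s : KauffmanState m n) (C : CatalanState m n) : Prop :=
  ∀ x y : BoundaryPoint m n n, componentAt s x = componentAt s y ↔ y = x ∨ y = C.partner x

/-- `p(s)`: the number of positive markers. -/
def positiveCount {m n : ℕ} (s : KauffmanState m n) : ℕ :=
  (Finset.univ.filter fun c : Fin m × Fin n => s c.1 c.2 = true).card

/-- `n(s)`: the number of negative markers. -/
def negativeCount {m n : ℕ} (s : KauffmanState m n) : ℕ :=
  (Finset.univ.filter fun c : Fin m × Fin n => s c.1 c.2 = false).card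

open LaurentPolynomial in
open scoped Classical in
/-- `C(A)`: the coefficient of the Catalan state `C` in the lattice crossing `L(m,n)`, the sum of
`A^(p(s) - n(s)) (-A^2 - A^(-2))^|D_s|` over the Kauffman states `s` with `C_s = C`.  Here `T k`
is the monomial `A^k`. -/
noncomputable def CatalanState.coefficient {m n : ℕ} (C : CatalanState m n) :
    LaurentPolynomial ℤ :=
  ∑ s : KauffmanState m n with Realizes s C,
    T ((positiveCount s : ℤ) - (negativeCount s : ℤ)) * (-T 2 - T (-2)) ^ closedCount s

end LatticeCrossing

/-!
The coefficient of a Catalan state is non-negative because all negative terms of its defining state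
sum come from states with closed components, and all such states cancel against others.

Read the rows from the top. Where a negative marker is followed by a positive one, the row closes
off a cup that opens downwards into the next row. As the vertical lines run above all horizontal
ones, a cup can be slid down through the rest of the lattice by second Reidemeister moves; on the
level of states this says that only those states matter in which every row continues each cup with
a negative marker at its left end and a positive marker at its right end. `Cup` describes the cups
at a given level, including those that enclose older cups, and `Passage` the piece of a horizontal
line that such cups leave connected.

A cup that meets a row with other markers is `Reducible`. There are three such pairs of markers,
`(+, -)`, `(+, +)` and `(-, -)`. The first splits off a closed component (`closed_of_pos_neg`), which
the other two merge into a neighbouring component (`merge_right`, `merge_left`), so that the three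
states have the same Catalan state and their contributions add up to a multiple of
`(-A^2 - A^(-2)) + A^2 + A^(-2) = 0`. Since the set of reducible cups down to the row in question is
the same for the three states (`reducible_congr`), the states with reducible cups fall into such
triples and cancel (`sum_weight_reducible`). A state without reducible cups has no closed components
at all (`closedCount_eq_zero`) and contributes a single power of `A`
(`coefficient_eq_sum_irreducible`).
-/

namespace LatticeCrossing

open Relation

variable {m n : ℕ}

/-! ### Cups and passages -/

/-- One step to the right along a horizontal line whose markers are `ρ`, when the vertical segments
above it are joined in pairs as `P` says: from the segment left of column `c`, up at `c`, over to a
column `e` with `P c e`, and back down to the segment right of `e`.  This is possible when the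
marker at `c` is negative and the one at `e` positive. -/
def Hop (P : Fin n → Fin n → Prop) (ρ : Fin n → Bool) (x y : Fin (n + 1)) : Prop :=
  ∃ c e, x = c.castSucc ∧ y = e.succ ∧ P c e ∧ ρ c = false ∧ ρ e = true

/-- `Cup s i c e`: the segments `vert i c` and `vert i e`, `c < e`, are joined inside the rows above
level `i` by an arc that leaves from the last of these rows at `c` to the right, passes all
older cups in between by hops, and comes back at `e`. -/
def Cup (s : KauffmanState m n) (i : Fin (m + 1)) : Fin n → Fin n → Prop :=
  Fin.induction (motive := fun _ => Fin n → Fin n → Prop) (fun _ _ => False)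
    (fun i P c e => s i c = false ∧ s i e = true ∧
      ReflTransGen (Hop P (s i)) c.succ e.castSucc) i

/-- `Passage s i x y`: the segments `horiz i x` and `horiz i y` are joined by a sequence of hops over
cups that end at the top of row `i`. -/
def Passage (s : KauffmanState m n) (i : Fin m) : Fin (n + 1) → Fin (n + 1) → Prop :=
  ReflTransGen (Hop (Cup s i.castSucc) (s i))

theorem not_cup_zero (s : KauffmanState m n) (c e : Fin n) : ¬ Cup s 0 c e := by
  simp [Cup]

theorem cup_succ {s : KauffmanState m n} {i : Fin m} {c e : Fin n} :
    Cup s i.succ c e ↔ s i c = false ∧ s i e = true ∧ Passage s i c.succ e.castSucc := by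
  simp only [Cup, Passage, Fin.induction_succ]

theorem cup_congr {s t : KauffmanState m n} (i : Fin (m + 1))
    (h : ∀ k : Fin m, k.castSucc < i → s k = t k) : Cup s i = Cup t i := by
  induction i using Fin.induction with
  | zero => rfl
  | succ i ih =>
    have h' := ih fun k hk => h k (hk.trans (Fin.castSucc_lt_succ))
    have hi := h i Fin.castSucc_lt_succ
    ext c e
    rw [cup_succ, cup_succ, Passage, Passage, h', hi]

theorem reflTransGen_hop_le {P : Fin n → Fin n → Prop} {ρ : Fin n → Bool}
    (hP : ∀ c e, P c e → c < e) {x y : Fin (n + 1)} (h : ReflTransGen (Hop P ρ) x y) : x ≤ y := by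
  induction h with
  | refl => exact le_rfl
  | tail _ hs ih =>
    obtain ⟨c, e, rfl, rfl, hce, -, -⟩ := hs
    have := hP _ _ hce
    simp only [Fin.le_def, Fin.lt_def, Fin.val_castSucc, Fin.val_succ] at *
    omega

theorem cup_lt {s : KauffmanState m n} {i : Fin (m + 1)} {c e : Fin n} (h : Cup s i c e) :
    c < e := by
  induction i using Fin.induction generalizing c e with
  | zero => exact (not_cup_zero s c e h).elim
  | succ i ih =>
    have := reflTransGen_hop_le (fun _ _ => ih) (cup_succ.1 h).2.2
    simp only [Fin.le_def, Fin.lt_def, Fin.val_castSucc, Fin.val_succ] at *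
    omega

theorem passage_le {s : KauffmanState m n} {i : Fin m} {x y : Fin (n + 1)}
    (h : Passage s i x y) : x ≤ y :=
  reflTransGen_hop_le (fun _ _ => cup_lt) h

theorem not_cup_right_of_cup_left {s : KauffmanState m n} {i : Fin (m + 1)} {c d e : Fin n}
    (h : Cup s i c d) : ¬ Cup s i d e := by
  induction i using Fin.induction with
  | zero => exact (not_cup_zero s _ _ h).elim
  | succ i =>
    rw [cup_succ] at *
    simp [h.2.1]

theorem cup_right_unique {s : KauffmanState m n} {i : Fin (m + 1)} {c e e' : Fin n}
    (h : Cup s i c e) (h' : Cup s i c e') : e = e' := by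
  induction i using Fin.induction generalizing c e e' with
  | zero => exact (not_cup_zero s _ _ h).elim
  | succ i ih =>
    rw [cup_succ] at *
    have hu : Relator.RightUnique (Hop (Cup s i.castSucc) (s i)) := by
      rintro x y z ⟨a, b, rfl, rfl, hab, -, -⟩ ⟨a', b', ha, rfl, hab', -, -⟩
      obtain rfl := Fin.castSucc_injective _ ha
      rw [ih hab hab']
    -- a positive marker stops every chain of hops
    have eq_of_passage : ∀ {a b : Fin n}, s i a = true → Passage s i a.castSucc b.castSucc →
        a = b := by
      intro a b ha hp
      rcases ReflTransGen.cases_head hp with hab | ⟨_, ⟨d, _, hd, -, -, hneg, -⟩, -⟩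
      · exact Fin.castSucc_injective _ hab
      · obtain rfl := Fin.castSucc_injective _ hd
        simp [ha] at hneg
    rcases ReflTransGen.total_of_right_unique hu h.2.2 h'.2.2 with hp | hp
    · exact eq_of_passage h.2.1 hp
    · exact (eq_of_passage h'.2.1 hp).symm

theorem cup_left_unique {s : KauffmanState m n} {i : Fin (m + 1)} {c c' e : Fin n}
    (h : Cup s i c e) (h' : Cup s i c' e) : c = c' := by
  induction i using Fin.induction generalizing c c' e with
  | zero => exact (not_cup_zero s _ _ h).elim
  | succ i ih =>
    rw [cup_succ] at *
    have hu : Relator.RightUnique (Function.swap (Hop (Cup s i.castSucc) (s i))) := by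
      rintro x y z ⟨a, b, rfl, rfl, hab, -, -⟩ ⟨a', b', rfl, hb, hab', -, -⟩
      obtain rfl := Fin.succ_injective _ hb
      rw [ih hab hab']
    -- a negative marker stops every chain of hops to the left
    have eq_of_passage : ∀ {a b : Fin n}, s i a = false → Passage s i b.succ a.succ → a = b := by
      intro a b ha hp
      rcases ReflTransGen.cases_tail hp with hab | ⟨_, -, ⟨_, d, -, hd, -, -, hpos⟩⟩
      · exact Fin.succ_injective _ hab
      · obtain rfl := Fin.succ_injective _ hd
        simp [ha] at hpos
    rcases ReflTransGen.total_of_right_unique hu (ReflTransGen.swap _ _ h.2.2)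
      (ReflTransGen.swap _ _ h'.2.2) with hp | hp
    · exact eq_of_passage h.1 (ReflTransGen.swap _ _ hp)
    · exact (eq_of_passage h'.1 (ReflTransGen.swap _ _ hp)).symm

/-! ### Cups and passages join their ends -/

/-- The component of `D_s` through a vertical segment. -/
abbrev vertComp (s : KauffmanState m n) (i : Fin (m + 1)) (j : Fin n) : Component s :=
  Quot.mk _ (.vert i j)

/-- The component of `D_s` through a horizontal segment. -/
abbrev horizComp (s : KauffmanState m n) (i : Fin m) (j : Fin (n + 1)) : Component s :=
  Quot.mk _ (.horiz i j)

theorem comp_pos_top {s : KauffmanState m n} {i : Fin m} {j : Fin n} (h : s i j = true) :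
    vertComp s i.castSucc j = horizComp s i j.succ := Quot.sound (.posTopRight i j h)

theorem comp_pos_bottom {s : KauffmanState m n} {i : Fin m} {j : Fin n} (h : s i j = true) :
    vertComp s i.succ j = horizComp s i j.castSucc := Quot.sound (.posBottomLeft i j h)

theorem comp_neg_top {s : KauffmanState m n} {i : Fin m} {j : Fin n} (h : s i j = false) :
    vertComp s i.castSucc j = horizComp s i j.castSucc := Quot.sound (.negTopLeft i j h)

theorem comp_neg_bottom {s : KauffmanState m n} {i : Fin m} {j : Fin n} (h : s i j = false) :
    vertComp s i.succ j = horizComp s i j.succ := Quot.sound (.negBottomRight i j h)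

theorem horizComp_eq_of_reflTransGen_hop {s : KauffmanState m n} {i : Fin m}
    {P : Fin n → Fin n → Prop}
    (hP : ∀ c e, P c e → vertComp s i.castSucc c = vertComp s i.castSucc e) {x y : Fin (n + 1)}
    (h : ReflTransGen (Hop P (s i)) x y) : horizComp s i x = horizComp s i y := by
  induction h with
  | refl => rfl
  | tail _ hs ih =>
    obtain ⟨c, e, rfl, rfl, hce, hc, he⟩ := hs
    rw [ih, ← comp_neg_top hc, hP c e hce, comp_pos_top he]

theorem vertComp_eq_of_cup {s : KauffmanState m n} {i : Fin (m + 1)} {c e : Fin n}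
    (h : Cup s i c e) : vertComp s i c = vertComp s i e := by
  induction i using Fin.induction generalizing c e with
  | zero => exact (not_cup_zero s c e h).elim
  | succ i ih =>
    rw [cup_succ] at h
    rw [comp_neg_bottom h.1, horizComp_eq_of_reflTransGen_hop (fun _ _ => ih) h.2.2,
      comp_pos_bottom h.2.1]

theorem horizComp_eq_of_passage {s : KauffmanState m n} {i : Fin m} {x y : Fin (n + 1)}
    (h : Passage s i x y) : horizComp s i x = horizComp s i y :=
  horizComp_eq_of_reflTransGen_hop (fun _ _ => vertComp_eq_of_cup) h

/-! ### The segments that make up a cup -/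

/-- Neither of the two strands at the crossing `(i, j)`, smoothed as in `s`, leads out of `S`. -/
def StableAt (s : KauffmanState m n) (S : Set (Segment m n)) (i : Fin m) (j : Fin n) : Prop :=
  (s i j = true → ((Segment.vert i.castSucc j ∈ S ↔ Segment.horiz i j.succ ∈ S) ∧
    (Segment.vert i.succ j ∈ S ↔ Segment.horiz i j.castSucc ∈ S))) ∧
  (s i j = false → ((Segment.vert i.castSucc j ∈ S ↔ Segment.horiz i j.castSucc ∈ S) ∧
    (Segment.vert i.succ j ∈ S ↔ Segment.horiz i j.succ ∈ S)))

theorem StableAt.union {s : KauffmanState m n} {S S' : Set (Segment m n)} {i : Fin m} {j : Fin n}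
    (h : StableAt s S i j) (h' : StableAt s S' i j) : StableAt s (S ∪ S') i j := by
  simp only [StableAt, Set.mem_union] at *
  grind

theorem stableAt_of_notMem {s : KauffmanState m n} {S : Set (Segment m n)} {i : Fin m} {j : Fin n}
    (h1 : Segment.vert i.castSucc j ∉ S) (h2 : Segment.vert i.succ j ∉ S)
    (h3 : Segment.horiz i j.castSucc ∉ S) (h4 : Segment.horiz i j.succ ∉ S) :
    StableAt s S i j := by
  simp [StableAt, h1, h2, h3, h4]

theorem mem_iff_mem_of_stableAt {s : KauffmanState m n} {S : Set (Segment m n)}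
    (h : ∀ i j, StableAt s S i j) {a b : Segment m n}
    (hab : (Quot.mk _ a : Component s) = Quot.mk _ b) : a ∈ S ↔ b ∈ S := by
  induction Quot.eqvGen_exact hab with
  | rel a b hj =>
    cases hj with
    | posTopRight i j hs => exact ((h i j).1 hs).1
    | posBottomLeft i j hs => exact ((h i j).1 hs).2
    | negTopLeft i j hs => exact ((h i j).2 hs).1
    | negBottomRight i j hs => exact ((h i j).2 hs).2
  | refl => rfl
  | symm a b h ih => exact (ih (Quot.eqvGen_sound h)).symm
  | trans a b c h1 h2 ih1 ih2 =>
    exact (ih1 (Quot.eqvGen_sound h1)).trans (ih2 (Quot.eqvGen_sound h2))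

/-- The set `S` of segments is an arc over the columns `c, …, e` that lies in the rows above level
`i` and ends at the bottom in `vert i c` and `vert i e`. -/
structure IsCupArc (s : KauffmanState m n) (i : Fin (m + 1)) (c e : Fin n)
    (S : Set (Segment m n)) : Prop where
  stableAt : ∀ k j, k.castSucc < i → StableAt s S k j
  vert_mem_iff : ∀ j, Segment.vert i j ∈ S ↔ j = c ∨ j = e
  of_vert_mem : ∀ k j, Segment.vert k j ∈ S → k ≤ i ∧ k ≠ 0 ∧ c ≤ j ∧ j ≤ e
  of_horiz_mem : ∀ k x, Segment.horiz k x ∈ S → k.castSucc < i ∧ c.succ ≤ x ∧ x ≤ e.castSucc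

/-- The set `S` of segments is an arc in row `i` and the rows above it that ends on the left in
`horiz i x` and on the right in `horiz i y`. -/
structure IsPassageArc (s : KauffmanState m n) (i : Fin m) (x y : Fin (n + 1))
    (S : Set (Segment m n)) : Prop where
  stableAt_above : ∀ k j, k < i → StableAt s S k j
  stableAt : ∀ j, x ≤ j.castSucc → j.castSucc < y → StableAt s S i j
  left_mem : Segment.horiz i x ∈ S
  right_mem : Segment.horiz i y ∈ S
  of_vert_mem : ∀ k j, Segment.vert k j ∈ S →
    k ≤ i.castSucc ∧ k ≠ 0 ∧ x ≤ j.castSucc ∧ j.castSucc < y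
  of_horiz_mem : ∀ k z, Segment.horiz k z ∈ S → k ≤ i ∧ x ≤ z ∧ z ≤ y

theorem exists_isPassageArc_of_reflTransGen {s : KauffmanState m n} {i : Fin m}
    {P : Fin n → Fin n → Prop} (hlt : ∀ c e, P c e → c < e)
    (hP : ∀ c e, P c e → ∃ S, IsCupArc s i.castSucc c e S)
    {x y : Fin (n + 1)} (h : ReflTransGen (Hop P (s i)) x y) : ∃ S, IsPassageArc s i x y S := by
  induction h with
  | refl =>
    refine ⟨{Segment.horiz i x}, ?_, ?_, rfl, rfl, ?_, ?_⟩
    · intro k j hk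
      apply stableAt_of_notMem <;> simp [hk.ne]
    · intro j h1 h2
      exact (h2.not_ge h1).elim
    · simp
    · simp +contextual
  | @tail y z hxy hs ih =>
    have hle := reflTransGen_hop_le hlt hxy
    obtain ⟨c, e, rfl, rfl, hce, hc, he⟩ := hs
    obtain ⟨S, hS⟩ := ih
    obtain ⟨S', hS'⟩ := hP c e hce
    have hce := hlt _ _ hce
    refine ⟨S ∪ S' ∪ {Segment.horiz i e.succ}, ?_, ?_, ?_, ?_, ?_, ?_⟩
    · intro k j hk
      refine ((hS.stableAt_above k j hk).union (hS'.stableAt k j ?_)).union ?_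
      · simpa using hk
      · apply stableAt_of_notMem <;> simp [hk.ne]
    · intro j h1 h2
      have n1 : Segment.vert i.succ j ∉ S := fun hm => by
        have := (hS.of_vert_mem _ _ hm).1
        exact absurd this (not_le.2 Fin.castSucc_lt_succ)
      have n2 : Segment.vert i.succ j ∉ S' := fun hm => by
        have := (hS'.of_vert_mem _ _ hm).1
        exact absurd this (not_le.2 Fin.castSucc_lt_succ)
      have n3 : ∀ z, Segment.horiz i z ∉ S' := fun z hm =>
        absurd (hS'.of_horiz_mem _ _ hm).1 (lt_irrefl _)
      have n4 : ∀ z, c.castSucc < z → Segment.horiz i z ∉ S := fun z hz hm =>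
        absurd (hS.of_horiz_mem _ _ hm).2.2 (not_le.2 hz)
      have n5 : c ≤ j → Segment.vert i.castSucc j ∉ S := fun hz hm =>
        absurd (hS.of_vert_mem _ _ hm).2.2.2 (not_lt.2 (by simpa using hz))
      rcases lt_or_ge j c with hj | hj
      · refine ((hS.stableAt j h1 (by simpa using hj)).union ?_).union ?_
        · apply stableAt_of_notMem
          · rw [hS'.vert_mem_iff]
            simp [hj.ne, (hj.trans hce).ne]
          all_goals first | exact n2 | exact n3 _
        · apply stableAt_of_notMem <;>
            simp [Fin.ext_iff] <;> simp only [Fin.lt_def] at * <;> omega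
      · simp only [StableAt, Set.mem_union, Set.mem_singleton_iff, hS'.vert_mem_iff, n1, n2, n3,
          n5 hj, Segment.horiz.injEq, reduceCtorEq, or_false, false_or, true_and, false_iff,
          n4 j.succ (by simp only [Fin.lt_def, Fin.le_def, Fin.val_succ, Fin.val_castSucc] at *;
                        omega)]
        have hsucc : j.succ = e.succ ↔ j = e := Fin.succ_inj
        have hcast : j.castSucc ≠ e.succ := by
          intro h
          simp only [Fin.ext_iff, Fin.lt_def, Fin.val_succ, Fin.val_castSucc] at *
          omega
        rw [hsucc]
        rcases eq_or_lt_of_le hj with rfl | hj'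
        · simp [hc, hS.right_mem, hce.ne]
        · simp only [n4 j.castSucc (by simpa using hj'), hj'.ne', hcast, false_or]
          rcases eq_or_ne j e with rfl | hje
          · simp [he]
          · simp [hje]
    · exact .inl (.inl hS.left_mem)
    · exact .inr rfl
    · rintro k j ((hm | hm) | hm)
      · have := hS.of_vert_mem _ _ hm
        refine ⟨this.1, this.2.1, this.2.2.1, ?_⟩
        have := this.2.2.2
        simp only [Fin.lt_def, Fin.val_succ, Fin.val_castSucc] at *
        omega
      · have := hS'.of_vert_mem _ _ hm
        refine ⟨this.1, this.2.1, ?_⟩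
        have := this.2.2
        simp only [Fin.lt_def, Fin.le_def, Fin.val_succ, Fin.val_castSucc] at *
        omega
      · simp at hm
    · rintro k z ((hm | hm) | hm)
      · have := hS.of_horiz_mem _ _ hm
        refine ⟨this.1, this.2.1, ?_⟩
        have := this.2.2
        simp only [Fin.lt_def, Fin.le_def, Fin.val_succ, Fin.val_castSucc] at *
        omega
      · have := hS'.of_horiz_mem _ _ hm
        simp only [Fin.lt_def, Fin.le_def, Fin.val_succ, Fin.val_castSucc] at *
        omega
      · simp only [Set.mem_singleton_iff, Segment.horiz.injEq] at hm
        obtain ⟨rfl, rfl⟩ := hm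
        simp only [Fin.lt_def, Fin.le_def, Fin.val_succ, Fin.val_castSucc] at *
        omega

theorem exists_isCupArc {s : KauffmanState m n} {i : Fin (m + 1)} {c e : Fin n}
    (h : Cup s i c e) : ∃ S, IsCupArc s i c e S := by
  induction i using Fin.induction generalizing c e with
  | zero => exact (not_cup_zero s c e h).elim
  | succ i ih =>
    have hlt := cup_lt h
    rw [cup_succ] at h
    obtain ⟨hc, he, hp⟩ := h
    obtain ⟨S, hS⟩ := exists_isPassageArc_of_reflTransGen (fun _ _ => cup_lt) (fun _ _ => ih) hp
    have n1 : ∀ j, Segment.vert i.succ j ∉ S := fun j hm =>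
      absurd (hS.of_vert_mem _ _ hm).1 (not_le.2 Fin.castSucc_lt_succ)
    refine ⟨S ∪ {Segment.vert i.succ c, Segment.vert i.succ e}, ?_, ?_, ?_, ?_⟩
    · intro k j hk
      rw [Fin.castSucc_lt_succ_iff] at hk
      rcases hk.lt_or_eq with hk | rfl
      · refine (hS.stableAt_above k j hk).union ?_
        apply stableAt_of_notMem <;> simp [Fin.ext_iff] <;> simp only [Fin.lt_def] at * <;> omega
      · by_cases hj : c < j ∧ j < e
        · refine (hS.stableAt j ?_ ?_).union ?_
          · simp only [Fin.lt_def, Fin.le_def, Fin.val_succ, Fin.val_castSucc] at *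
            omega
          · simpa using hj.2
          · apply stableAt_of_notMem <;>
              simp [Fin.ext_iff] <;> simp only [Fin.lt_def] at * <;> omega
        · have v : Segment.vert k.castSucc j ∉ S := fun hm => hj <| by
            have := (hS.of_vert_mem _ _ hm).2.2
            simp only [Fin.lt_def, Fin.le_def, Fin.val_succ, Fin.val_castSucc] at *
            omega
          have hz : ∀ z, ¬ (c.succ ≤ z ∧ z ≤ e.castSucc) → Segment.horiz k z ∉ S :=
            fun z hz hm => hz (hS.of_horiz_mem _ _ hm).2
          rcases eq_or_ne j c with rfl | hjc
          · have := hS.left_mem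
            have := hz j.castSucc (by simp)
            have : k.castSucc ≠ k.succ := Fin.castSucc_lt_succ.ne
            simp_all [StableAt]
          rcases eq_or_ne j e with rfl | hje
          · have := hS.right_mem
            have := hz j.succ (by simp)
            have : k.castSucc ≠ k.succ := Fin.castSucc_lt_succ.ne
            simp_all [StableAt]
          have h1 := hz j.castSucc (by
            simp only [Fin.lt_def, Fin.le_def, Fin.val_succ, Fin.val_castSucc, ne_eq,
              Fin.ext_iff] at *
            omega)
          have h2 := hz j.succ (by
            simp only [Fin.lt_def, Fin.le_def, Fin.val_succ, Fin.val_castSucc, ne_eq,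
              Fin.ext_iff] at *
            omega)
          have : k.castSucc ≠ k.succ := Fin.castSucc_lt_succ.ne
          apply stableAt_of_notMem <;> simp [*]
    · intro j
      simp [n1]
    · rintro k j (hm | hm)
      · have := hS.of_vert_mem _ _ hm
        refine ⟨this.1.trans Fin.castSucc_lt_succ.le, this.2.1, ?_⟩
        have := this.2.2
        simp only [Fin.lt_def, Fin.le_def, Fin.val_succ, Fin.val_castSucc] at *
        omega
      · simp only [Set.mem_insert_iff, Set.mem_singleton_iff, Segment.vert.injEq] at hm
        rcases hm with ⟨rfl, rfl⟩ | ⟨rfl, rfl⟩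
        · exact ⟨le_rfl, Fin.succ_ne_zero _, le_rfl, hlt.le⟩
        · exact ⟨le_rfl, Fin.succ_ne_zero _, hlt.le, le_rfl⟩
    · rintro k z (hm | hm)
      · have := hS.of_horiz_mem _ _ hm
        exact ⟨Fin.castSucc_lt_succ_iff.2 this.1, this.2⟩
      · simp at hm

theorem exists_isPassageArc {s : KauffmanState m n} {i : Fin m} {x y : Fin (n + 1)}
    (h : Passage s i x y) : ∃ S, IsPassageArc s i x y S :=
  exists_isPassageArc_of_reflTransGen (fun _ _ => cup_lt) (fun _ _ => exists_isCupArc) h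

/-! ### Merging a closed class with another class -/

/-- Suppose that `r'` generates the equivalence relation obtained from that of `r` by merging the
class of `u` with the different class of `z`, and that no boundary value `b x` lies in the class of
`u`.  Then `r'` and `r` relate the same boundary values, and `r'` has one closed class less. -/
theorem card_closed_of_merge {V B : Type*} [Finite V] {r r' : V → V → Prop} {b : B → V} {u z : V}
    (hu : ∀ x, (Quot.mk r (b x)) ≠ Quot.mk r u) (hz : Quot.mk r z ≠ Quot.mk r u)
    (h1 : ∀ a c, r a c → Quot.mk r' a = Quot.mk r' c)
    (h2 : ∀ a c, r' a c → Quot.mk r a = Quot.mk r c ∨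
      (Quot.mk r a = Quot.mk r u ∧ Quot.mk r c = Quot.mk r z) ∨
      (Quot.mk r a = Quot.mk r z ∧ Quot.mk r c = Quot.mk r u))
    (h3 : Quot.mk r' u = Quot.mk r' z) :
    (∀ x y, Quot.mk r' (b x) = Quot.mk r' (b y) ↔ Quot.mk r (b x) = Quot.mk r (b y)) ∧
    Nat.card {q : Quot r // ∀ x, Quot.mk r (b x) ≠ q} =
      Nat.card {q : Quot r' // ∀ x, Quot.mk r' (b x) ≠ q} + 1 := by
  classical
  let ψ : Quot r → Quot r' := Quot.lift (Quot.mk r') h1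
  let f : V → Quot r := fun a => if Quot.mk r a = Quot.mk r u then Quot.mk r z else Quot.mk r a
  let φ : Quot r' → Quot r := Quot.lift f fun a c h => by
    rcases h2 a c h with h | ⟨ha, hc⟩ | ⟨ha, hc⟩
    · simp [f, h]
    · simp [f, ha, hc]
    · simp [f, ha, hc]
  have hφb : ∀ x, φ (Quot.mk r' (b x)) = Quot.mk r (b x) := fun x => if_neg (hu x)
  have hψφ : ∀ q, ψ (φ q) = q := by
    rintro ⟨a⟩
    change ψ (f a) = _
    by_cases ha : Quot.mk r a = Quot.mk r u
    · simp only [f, if_pos ha]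
      calc ψ (Quot.mk r z) = Quot.mk r' z := rfl
        _ = ψ (Quot.mk r u) := h3.symm
        _ = ψ (Quot.mk r a) := by rw [ha]
    · simp only [f, if_neg ha]
      rfl
  have hφψ : ∀ p, p ≠ Quot.mk r u → φ (ψ p) = p := by
    rintro ⟨a⟩ ha
    exact if_neg ha
  have hφu : ∀ q, φ q ≠ Quot.mk r u := by
    rintro ⟨a⟩
    change f a ≠ _
    by_cases ha : Quot.mk r a = Quot.mk r u
    · simpa only [f, if_pos ha] using hz
    · simpa only [f, if_neg ha] using ha
  have hinj : Function.Injective φ := Function.LeftInverse.injective hψφ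
  refine ⟨fun x y => ?_, ?_⟩
  · rw [← hφb x, ← hφb y]
    exact hinj.eq_iff.symm
  · have : {q : Quot r | ∀ x, Quot.mk r (b x) ≠ q} =
        insert (Quot.mk r u) (φ '' {q : Quot r' | ∀ x, Quot.mk r' (b x) ≠ q}) := by
      ext p
      simp only [Set.mem_ofPred_eq, Set.mem_insert_iff, Set.mem_image]
      constructor
      · intro hp
        by_cases hpu : p = Quot.mk r u
        · exact .inl hpu
        · refine .inr ⟨ψ p, fun x hx => hp x ?_, hφψ p hpu⟩
          rw [← hφb x, hx, hφψ p hpu]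
      · rintro (rfl | ⟨q, hq, rfl⟩)
        · exact hu
        · intro x hx
          exact hq x (hinj (by rw [hφb, hx]))
    change Set.ncard {q : Quot r | ∀ x, Quot.mk r (b x) ≠ q} = _
    rw [this, Set.ncard_insert_of_notMem, Set.ncard_image_of_injective _ hinj]
    · rfl
    · rintro ⟨q, -, hq⟩
      exact hφu q hq

instance : Finite (Segment m n) :=
  Finite.of_surjective
    (Sum.elim (fun p : Fin (m + 1) × Fin n => Segment.vert p.1 p.2)
      (fun p : Fin m × Fin (n + 1) => Segment.horiz p.1 p.2)) <| by
    rintro (⟨i, j⟩ | ⟨i, j⟩)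
    · exact ⟨.inl (i, j), rfl⟩
    · exact ⟨.inr (i, j), rfl⟩

/-! ### Reducible cups -/

/-- A cup that reaches the top of row `i` at the columns `c` and `e`, whose ends are also joined
along row `i` between these columns up to the two crossings `(i, c)` and `(i, e)`, and which does not
slide through row `i` because the markers there are not negative and positive. -/
def Reducible (s : KauffmanState m n) (i : Fin m) (c e : Fin n) : Prop :=
  Cup s i.castSucc c e ∧ Passage s i c.succ e.castSucc ∧ ¬ (s i c = false ∧ s i e = true)

/-- A reducible cup in the first row that has any. -/
def FirstReducible (s : KauffmanState m n) (p : Fin m × Fin n × Fin n) : Prop :=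
  Reducible s p.1 p.2.1 p.2.2 ∧ ∀ k < p.1, ∀ c e, ¬ Reducible s k c e

theorem exists_firstReducible {s : KauffmanState m n} (h : ∃ i c e, Reducible s i c e) :
    ∃ p, FirstReducible s p := by
  obtain ⟨i, ⟨c, e, hi⟩, hmin⟩ :=
    WellFounded.has_min (wellFounded_lt (α := Fin m)) {i | ∃ c e, Reducible s i c e} h
  exact ⟨(i, c, e), hi, fun k hk c' e' h' => hmin k ⟨c', e', h'⟩ hk⟩

/-- Reducibility in the rows down to `i` does not notice a change of the markers at the ends of a
cup over row `i`, as long as the cup remains unable to slide through the row. -/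
theorem reducible_congr {s t : KauffmanState m n} {i : Fin m} {c e : Fin n}
    (hcup : Cup s i.castSucc c e) (hs : ¬ (s i c = false ∧ s i e = true))
    (ht : ¬ (t i c = false ∧ t i e = true))
    (hst : ∀ k j, (k = i → j ≠ c ∧ j ≠ e) → s k j = t k j) {k : Fin m} (hk : k ≤ i) :
    Reducible s k = Reducible t k := by
  have hrow : ∀ l < i, s l = t l := fun l hl => funext fun j => hst l j fun h => (hl.ne h).elim
  have hcups : Cup s k.castSucc = Cup t k.castSucc :=
    cup_congr _ fun l hl => hrow l ((Fin.castSucc_lt_castSucc_iff.1 hl).trans_le hk)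
  rcases hk.lt_or_eq with hk | rfl
  · ext c' e'
    rw [Reducible, Reducible, Passage, Passage, hcups, hrow k hk]
  -- Two cups that share an end are equal, so all other cups keep their markers.
  have key : ∀ a b, Cup s k.castSucc a b →
      ((s k a = false ∧ s k b = true) ↔ (t k a = false ∧ t k b = true)) := by
    intro a b hab
    by_cases ha : a = c
    · subst ha
      obtain rfl := cup_right_unique hab hcup
      simp only [hs, ht]
    · have ha' : a ≠ e := by
        rintro rfl
        exact not_cup_right_of_cup_left hcup hab
      have hb : b ≠ c := by
        rintro rfl
        exact not_cup_right_of_cup_left hab hcup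
      have hb' : b ≠ e := by
        rintro rfl
        exact ha (cup_left_unique hab hcup)
      rw [hst k a fun _ => ⟨ha, ha'⟩, hst k b fun _ => ⟨hb, hb'⟩]
  have hhop : Hop (Cup s k.castSucc) (s k) = Hop (Cup t k.castSucc) (t k) := by
    ext x y
    rw [← hcups]
    constructor
    · rintro ⟨a, b, rfl, rfl, hab, h⟩
      exact ⟨a, b, rfl, rfl, hab, (key a b hab).1 h⟩
    · rintro ⟨a, b, rfl, rfl, hab, h⟩
      exact ⟨a, b, rfl, rfl, hab, (key a b hab).2 h⟩
  ext a b
  simp only [Reducible, Passage, hhop, ← hcups]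
  exact and_congr_right fun hab => and_congr_right fun _ => not_congr (key a b hab)

theorem firstReducible_congr {s t : KauffmanState m n} {i : Fin m} {c e : Fin n}
    (h : FirstReducible s (i, c, e)) (ht : ¬ (t i c = false ∧ t i e = true))
    (hst : ∀ k j, (k = i → j ≠ c ∧ j ≠ e) → s k j = t k j) :
    FirstReducible s = FirstReducible t := by
  have hcongr : ∀ k ≤ i, Reducible s k = Reducible t k :=
    fun k hk => reducible_congr h.1.1 h.1.2.2 ht hst hk
  have h' : Reducible t i c e := hcongr i le_rfl ▸ h.1
  ext ⟨k, a, b⟩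
  simp only [FirstReducible]
  by_cases hk : k ≤ i
  · rw [hcongr k hk]
    refine and_congr_right fun _ => forall_congr' fun l => forall_congr' fun hl => ?_
    rw [hcongr l (hl.le.trans hk)]
  · push Not at hk
    exact iff_of_false (fun hf => hf.2 i hk c e h.1) (fun hf => hf.2 i hk c e h')

/-! ### The closed component at a reducible cup -/

/-- With a positive marker at the left end and a negative one at the right end, a cup and the
passage below it close up to a component that meets neither the boundary nor the outer side of
these two crossings. -/
theorem closed_of_pos_neg {s : KauffmanState m n} {i : Fin m} {c e : Fin n}
    (hcup : Cup s i.castSucc c e) (hp : Passage s i c.succ e.castSucc)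
    (hc : s i c = true) (he : s i e = false) :
    (∀ x, componentAt s x ≠ vertComp s i.castSucc c) ∧
    horizComp s i c.castSucc ≠ vertComp s i.castSucc c ∧
    horizComp s i e.succ ≠ vertComp s i.castSucc c := by
  obtain ⟨S, hS⟩ := exists_isCupArc hcup
  obtain ⟨S', hS'⟩ := exists_isPassageArc hp
  have hlt := cup_lt hcup
  have ne : i.castSucc ≠ i.succ := Fin.castSucc_lt_succ.ne
  have n1 : ∀ k j, i.castSucc < k → Segment.vert k j ∉ S ∪ S' := by
    rintro k j hk (hm | hm)
    · exact absurd (hS.of_vert_mem _ _ hm).1 (not_le.2 hk)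
    · exact absurd (hS'.of_vert_mem _ _ hm).1 (not_le.2 hk)
  have n2 : ∀ k x, ¬ (c.succ ≤ x ∧ x ≤ e.castSucc) → Segment.horiz k x ∉ S ∪ S' := by
    rintro k x hx (hm | hm)
    · exact hx (hS.of_horiz_mem _ _ hm).2
    · exact hx (hS'.of_horiz_mem _ _ hm).2
  have n3 : ∀ k x, i < k → Segment.horiz k x ∉ S ∪ S' := by
    rintro k x hk (hm | hm)
    · exact absurd (hS.of_horiz_mem _ _ hm).1 (not_lt.2 (Fin.castSucc_le_castSucc_iff.2 hk.le))
    · exact absurd (hS'.of_horiz_mem _ _ hm).1 (not_le.2 hk)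
  have n4 : ∀ x, Segment.horiz i x ∉ S := fun x hm =>
    absurd (hS.of_horiz_mem _ _ hm).1 (lt_irrefl _)
  have hv : ∀ j, Segment.vert i.castSucc j ∈ S' → c < j ∧ j < e := by
    intro j hm
    have := (hS'.of_vert_mem _ _ hm).2.2
    simp only [Fin.lt_def, Fin.le_def, Fin.val_succ, Fin.val_castSucc] at *
    omega
  have stable : ∀ k j, StableAt s (S ∪ S') k j := by
    intro k j
    rcases lt_trichotomy k i with hk | rfl | hk
    · exact (hS.stableAt k j (by simpa using hk)).union (hS'.stableAt_above k j hk)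
    · have hb := n1 k.succ j Fin.castSucc_lt_succ
      by_cases hj : c < j ∧ j < e
      · refine StableAt.union ?_ (hS'.stableAt j ?_ ?_)
        · apply stableAt_of_notMem
          · rw [hS.vert_mem_iff]
            rintro (rfl | rfl)
            · exact lt_irrefl _ hj.1
            · exact lt_irrefl _ hj.2
          · exact fun h => hb (.inl h)
          · exact n4 _
          · exact n4 _
        · simp only [Fin.lt_def, Fin.le_def, Fin.val_succ, Fin.val_castSucc] at *
          omega
        · simpa using hj.2
      rcases eq_or_ne j c with rfl | hjc
      · have h1 := n2 k j.castSucc (by simp)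
        have h2 : Segment.vert k.castSucc j ∈ S ∪ S' := .inl ((hS.vert_mem_iff j).2 (.inl rfl))
        have h3 : Segment.horiz k j.succ ∈ S ∪ S' := .inr hS'.left_mem
        simp [StableAt, -Set.mem_union, h1, h2, h3, hb, hc]
      rcases eq_or_ne j e with rfl | hje
      · have h1 := n2 k j.succ (by simp)
        have h2 : Segment.vert k.castSucc j ∈ S ∪ S' := .inl ((hS.vert_mem_iff j).2 (.inr rfl))
        have h3 : Segment.horiz k j.castSucc ∈ S ∪ S' := .inr hS'.right_mem
        simp [StableAt, -Set.mem_union, h1, h2, h3, hb, he]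
      · apply stableAt_of_notMem
        · rintro (hm | hm)
          · rw [hS.vert_mem_iff] at hm
            exact hm.elim hjc hje
          · exact hj (hv j hm)
        · exact hb
        · refine n2 _ _ ?_
          simp only [Fin.lt_def, Fin.le_def, Fin.val_succ, Fin.val_castSucc, ne_eq,
            Fin.ext_iff] at *
          omega
        · refine n2 _ _ ?_
          simp only [Fin.lt_def, Fin.le_def, Fin.val_succ, Fin.val_castSucc, ne_eq,
            Fin.ext_iff] at *
          omega
    · apply stableAt_of_notMem
      · exact n1 _ _ (Fin.castSucc_lt_castSucc_iff.2 hk)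
      · exact n1 _ _ ((Fin.castSucc_lt_castSucc_iff.2 hk).trans Fin.castSucc_lt_succ)
      · exact n3 _ _ hk
      · exact n3 _ _ hk
  have hmem : Segment.vert i.castSucc c ∈ S ∪ S' := .inl ((hS.vert_mem_iff c).2 (.inl rfl))
  have out : ∀ a, a ∉ S ∪ S' → (Quot.mk _ a : Component s) ≠ vertComp s i.castSucc c :=
    fun a ha h => ha ((mem_iff_mem_of_stableAt stable h).2 hmem)
  refine ⟨?_, out _ (n2 _ _ (by simp)), out _ (n2 _ _ (by simp))⟩
  rintro (j | k | j | k)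
  · refine out _ ?_
    rintro (hm | hm)
    · exact (hS.of_vert_mem _ _ hm).2.1 rfl
    · exact (hS'.of_vert_mem _ _ hm).2.1 rfl
  · refine out _ (n2 _ _ ?_)
    simp only [Fin.le_def, Fin.val_last, Fin.val_castSucc]
    omega
  · exact out _ (n1 _ _ (Fin.castSucc_lt_last i))
  · refine out _ (n2 _ _ ?_)
    simp

/-- Changing the markers at the ends of a cup from `(+, -)` to `(+, +)` joins the closed component at
the cup to the strand through the outer side of the right crossing. -/
theorem merge_right {s t : KauffmanState m n} {i : Fin m} {c e : Fin n}
    (hcup : Cup s i.castSucc c e) (hp : Passage s i c.succ e.castSucc)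
    (hcup' : Cup t i.castSucc c e) (hp' : Passage t i c.succ e.castSucc)
    (hc : s i c = true) (he : s i e = false) (he' : t i e = true)
    (hst : ∀ k j, (k = i → j ≠ e) → s k j = t k j) :
    (∀ x y, componentAt t x = componentAt t y ↔ componentAt s x = componentAt s y) ∧
      closedCount s = closedCount t + 1 := by
  obtain ⟨hb, -, hR⟩ := closed_of_pos_neg hcup hp hc he
  have hlt := cup_lt hcup
  have hc' : t i c = true := by rw [← hst i c fun _ => hlt.ne, hc]
  -- In `t` the component of the cup runs on to the right of `(i, e)`.
  have loop : horizComp s i e.castSucc = vertComp s i.castSucc c := by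
    rw [← horizComp_eq_of_passage hp, comp_pos_top hc]
  have loop' : horizComp t i e.castSucc = vertComp t i.castSucc c := by
    rw [← horizComp_eq_of_passage hp', comp_pos_top hc']
  have hR' : vertComp t i.castSucc c = horizComp t i e.succ := by
    rw [vertComp_eq_of_cup hcup', comp_pos_top he']
  refine card_closed_of_merge (u := Segment.vert i.castSucc c) (z := Segment.horiz i e.succ)
    hb hR ?_ ?_ hR'
  · rintro _ _ (⟨k, j, h⟩ | ⟨k, j, h⟩ | ⟨k, j, h⟩ | ⟨k, j, h⟩)
    · refine comp_pos_top (?_ : t k j = true)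
      rw [← hst k j (by rintro rfl rfl; simp [he] at h), h]
    · refine comp_pos_bottom (?_ : t k j = true)
      rw [← hst k j (by rintro rfl rfl; simp [he] at h), h]
    · by_cases hk : k = i → j ≠ e
      · exact comp_neg_top (by rw [← hst k j hk, h])
      · push Not at hk
        obtain ⟨rfl, rfl⟩ := hk
        exact (vertComp_eq_of_cup hcup').symm.trans loop'.symm
    · by_cases hk : k = i → j ≠ e
      · exact comp_neg_bottom (by rw [← hst k j hk, h])
      · push Not at hk
        obtain ⟨rfl, rfl⟩ := hk
        exact (comp_pos_bottom he').trans (loop'.trans hR')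
  · rintro _ _ (⟨k, j, h⟩ | ⟨k, j, h⟩ | ⟨k, j, h⟩ | ⟨k, j, h⟩)
    · by_cases hk : k = i → j ≠ e
      · exact .inl (comp_pos_top (by rw [hst k j hk, h]))
      · push Not at hk
        obtain ⟨rfl, rfl⟩ := hk
        exact .inr (.inl ⟨(vertComp_eq_of_cup hcup).symm, rfl⟩)
    · by_cases hk : k = i → j ≠ e
      · exact .inl (comp_pos_bottom (by rw [hst k j hk, h]))
      · push Not at hk
        obtain ⟨rfl, rfl⟩ := hk
        exact .inr (.inr ⟨comp_neg_bottom he, loop⟩)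
    · refine .inl (comp_neg_top (?_ : s k j = false))
      rw [hst k j (by rintro rfl rfl; simp [he'] at h), h]
    · refine .inl (comp_neg_bottom (?_ : s k j = false))
      rw [hst k j (by rintro rfl rfl; simp [he'] at h), h]

/-- Changing the markers at the ends of a cup from `(+, -)` to `(-, -)` joins the closed component at
the cup to the strand through the outer side of the left crossing. -/
theorem merge_left {s t : KauffmanState m n} {i : Fin m} {c e : Fin n}
    (hcup : Cup s i.castSucc c e) (hp : Passage s i c.succ e.castSucc)
    (hcup' : Cup t i.castSucc c e) (hp' : Passage t i c.succ e.castSucc)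
    (hc : s i c = true) (he : s i e = false) (hc' : t i c = false)
    (hst : ∀ k j, (k = i → j ≠ c) → s k j = t k j) :
    (∀ x y, componentAt t x = componentAt t y ↔ componentAt s x = componentAt s y) ∧
      closedCount s = closedCount t + 1 := by
  obtain ⟨hb, hL, -⟩ := closed_of_pos_neg hcup hp hc he
  have hlt := cup_lt hcup
  have he' : t i e = false := by rw [← hst i e fun _ => hlt.ne', he]
  -- In `t` the component of the cup runs on to the left of `(i, c)`.
  have loop' : horizComp t i c.succ = vertComp t i.castSucc c := by
    rw [horizComp_eq_of_passage hp', ← comp_neg_top he', vertComp_eq_of_cup hcup']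
  have hL' : vertComp t i.castSucc c = horizComp t i c.castSucc := comp_neg_top hc'
  refine card_closed_of_merge (u := Segment.vert i.castSucc c) (z := Segment.horiz i c.castSucc)
    hb hL ?_ ?_ hL'
  · rintro _ _ (⟨k, j, h⟩ | ⟨k, j, h⟩ | ⟨k, j, h⟩ | ⟨k, j, h⟩)
    · by_cases hk : k = i → j ≠ c
      · exact comp_pos_top (by rw [← hst k j hk, h])
      · push Not at hk
        obtain ⟨rfl, rfl⟩ := hk
        exact loop'.symm
    · by_cases hk : k = i → j ≠ c
      · exact comp_pos_bottom (by rw [← hst k j hk, h])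
      · push Not at hk
        obtain ⟨rfl, rfl⟩ := hk
        exact (comp_neg_bottom hc').trans (loop'.trans hL')
    · refine comp_neg_top (?_ : t k j = false)
      rw [← hst k j (by rintro rfl rfl; simp [hc] at h), h]
    · refine comp_neg_bottom (?_ : t k j = false)
      rw [← hst k j (by rintro rfl rfl; simp [hc] at h), h]
  · rintro _ _ (⟨k, j, h⟩ | ⟨k, j, h⟩ | ⟨k, j, h⟩ | ⟨k, j, h⟩)
    · refine .inl (comp_pos_top (?_ : s k j = true))
      rw [hst k j (by rintro rfl rfl; simp [hc'] at h), h]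
    · refine .inl (comp_pos_bottom (?_ : s k j = true))
      rw [hst k j (by rintro rfl rfl; simp [hc'] at h), h]
    · by_cases hk : k = i → j ≠ c
      · exact .inl (comp_neg_top (by rw [hst k j hk, h]))
      · push Not at hk
        obtain ⟨rfl, rfl⟩ := hk
        exact .inr (.inl ⟨rfl, rfl⟩)
    · by_cases hk : k = i → j ≠ c
      · exact .inl (comp_neg_bottom (by rw [hst k j hk, h]))
      · push Not at hk
        obtain ⟨rfl, rfl⟩ := hk
        exact .inr (.inr ⟨comp_pos_bottom hc, (comp_pos_top hc).symm⟩)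

/-! ### States without reducible cups -/

/-- If no cup is reducible, then every cup slides down through the next row. -/
theorem passage_of_cup {s : KauffmanState m n} (hs : ∀ i c e, ¬ Reducible s i c e) {i : Fin m}
    {c e : Fin n} (h : Cup s i.castSucc c e) : Passage s i c.succ e.castSucc := by
  obtain ⟨k, hk⟩ := i
  induction k generalizing c e with
  | zero => exact (not_cup_zero s c e h).elim
  | succ k ih =>
    -- The cups inside `(c, e)` are handled first.
    induction hw : (e : ℕ) - c using Nat.strong_induction_on generalizing c e with
    | _ w ihw =>
      subst hw
      have hk' : k < m := by omega
      have hcast : (⟨k + 1, hk⟩ : Fin m).castSucc = (⟨k, hk'⟩ : Fin m).succ := rfl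
      have hp := (cup_succ.1 (hcast ▸ h)).2.2
      have hce := cup_lt h
      have step : ∀ x, Passage s ⟨k, hk'⟩ c.succ x → x ≤ e.castSucc →
          Passage s ⟨k + 1, hk⟩ c.succ x := by
        intro x hx
        induction hx with
        | refl => exact fun _ => .refl
        | tail hx hhop ihx =>
          intro hle
          obtain ⟨a, b, rfl, rfl, hab, ha, hb⟩ := hhop
          have hlt := cup_lt hab
          have hcup : Cup s (⟨k + 1, hk⟩ : Fin m).castSucc a b :=
            hcast ▸ cup_succ.2 ⟨ha, hb, ih hk' hab⟩
          have hca := passage_le hx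
          simp only [Fin.lt_def, Fin.le_def, Fin.val_succ, Fin.val_castSucc] at *
          have hin := ihw (b - a) (by omega) hcup rfl
          have hsign : s ⟨k + 1, hk⟩ a = false ∧ s ⟨k + 1, hk⟩ b = true := by
            by_contra hcon
            exact hs _ _ _ ⟨hcup, hin, hcon⟩
          exact (ihx (by omega)).tail ⟨a, b, rfl, rfl, hcup, hsign⟩
      exact step _ hp le_rfl

theorem markers_of_cup {s : KauffmanState m n} (hs : ∀ i c e, ¬ Reducible s i c e) {i : Fin m}
    {c e : Fin n} (h : Cup s i.castSucc c e) : s i c = false ∧ s i e = true := by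
  by_contra hcon
  exact hs _ _ _ ⟨h, passage_of_cup hs h, hcon⟩

/-- Hops lead from any place in a row to the left until they reach the side of the rectangle or a
column `d` at which no cup has its right end. -/
theorem exists_passage_left {s : KauffmanState m n} (hs : ∀ i c e, ¬ Reducible s i c e)
    (i : Fin m) (x : Fin (n + 1)) : ∃ y, Passage s i y x ∧
      (y = 0 ∨ ∃ d, y = d.succ ∧ ∀ a, ¬ Cup s i.castSucc a d) := by
  induction x using WellFoundedLT.induction with
  | _ x ih =>
    rcases Fin.eq_zero_or_eq_succ x with rfl | ⟨d, rfl⟩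
    · exact ⟨0, .refl, .inl rfl⟩
    · by_cases hd : ∃ a, Cup s i.castSucc a d
      · obtain ⟨a, ha⟩ := hd
        obtain ⟨y, hy, hy'⟩ := ih a.castSucc
          (lt_trans (Fin.castSucc_lt_castSucc_iff.2 (cup_lt ha)) Fin.castSucc_lt_succ)
        exact ⟨y, hy.tail ⟨a, d, rfl, rfl, ha, markers_of_cup hs ha⟩, hy'⟩
      · exact ⟨d.succ, .refl, .inr ⟨d, rfl, not_exists.1 hd⟩⟩

/-- Hops lead from any place in a row to the right until they reach the side of the rectangle or a
column `d` at which no cup has its left end. -/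
theorem exists_passage_right {s : KauffmanState m n} (hs : ∀ i c e, ¬ Reducible s i c e)
    (i : Fin m) (x : Fin (n + 1)) : ∃ y, Passage s i x y ∧
      (y = Fin.last n ∨ ∃ d, y = d.castSucc ∧ ∀ a, ¬ Cup s i.castSucc d a) := by
  induction x using WellFoundedGT.induction with
  | _ x ih =>
    rcases Fin.eq_castSucc_or_eq_last x with ⟨d, rfl⟩ | rfl
    · by_cases hd : ∃ a, Cup s i.castSucc d a
      · obtain ⟨a, ha⟩ := hd
        obtain ⟨y, hy, hy'⟩ := ih a.succ
          (lt_trans (Fin.castSucc_lt_castSucc_iff.2 (cup_lt ha)) Fin.castSucc_lt_succ)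
        exact ⟨y, .head ⟨d, a, rfl, rfl, ha, markers_of_cup hs ha⟩ hy, hy'⟩
      · exact ⟨d.castSucc, .refl, .inr ⟨d, rfl, not_exists.1 hd⟩⟩
    · exact ⟨Fin.last n, .refl, .inl rfl⟩

/-- A component of `D_s` that reaches the boundary. -/
def IsOpenComp (s : KauffmanState m n) (q : Component s) : Prop :=
  ∃ x, componentAt s x = q

theorem isOpenComp_left (s : KauffmanState m n) (i : Fin m) : IsOpenComp s (horizComp s i 0) :=
  ⟨.left i, rfl⟩

theorem isOpenComp_right (s : KauffmanState m n) (i : Fin m) :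
    IsOpenComp s (horizComp s i (Fin.last n)) := ⟨.right i, rfl⟩

/-- Without reducible cups, a vertical segment at which no cup ends is joined to the boundary
through the rows above it. -/
theorem isOpenComp_of_not_cup {s : KauffmanState m n} (hs : ∀ i c e, ¬ Reducible s i c e)
    (i : Fin (m + 1)) (c : Fin n) (h1 : ∀ e, ¬ Cup s i c e) (h2 : ∀ e, ¬ Cup s i e c) :
    IsOpenComp s (vertComp s i c) := by
  induction i using Fin.induction generalizing c with
  | zero => exact ⟨.top c, rfl⟩
  | succ i ih =>
    cases hc : s i c with
    | true =>
      rw [comp_pos_bottom hc]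
      obtain ⟨y, hy, rfl | ⟨d, rfl, hd⟩⟩ := exists_passage_left hs i c.castSucc
      · rw [← horizComp_eq_of_passage hy]
        exact isOpenComp_left s i
      · rw [← horizComp_eq_of_passage hy]
        cases hsd : s i d with
        | false => exact (h2 d (cup_succ.2 ⟨hsd, hc, hy⟩)).elim
        | true =>
          rw [← comp_pos_top hsd]
          refine ih d (fun e he => ?_) hd
          simpa [hsd] using (markers_of_cup hs he).1
    | false =>
      rw [comp_neg_bottom hc]
      obtain ⟨y, hy, rfl | ⟨d, rfl, hd⟩⟩ := exists_passage_right hs i c.succ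
      · rw [horizComp_eq_of_passage hy]
        exact isOpenComp_right s i
      · rw [horizComp_eq_of_passage hy]
        cases hsd : s i d with
        | true => exact (h1 d (cup_succ.2 ⟨hc, hsd, hy⟩)).elim
        | false =>
          rw [← comp_neg_top hsd]
          refine ih d hd (fun e he => ?_)
          simpa [hsd] using (markers_of_cup hs he).2

/-- A segment that belongs to a cup is followed downwards: the bottom side is reached at the latest. -/
theorem isOpenComp_vertComp {s : KauffmanState m n} (hs : ∀ i c e, ¬ Reducible s i c e)
    (i : Fin (m + 1)) (c : Fin n) : IsOpenComp s (vertComp s i c) := by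
  induction i using Fin.reverseInduction generalizing c with
  | last => exact ⟨.bottom c, rfl⟩
  | cast i ih =>
    -- Leave a cup at its left end and turn left; the next turn goes up to a free end or down.
    have main : ∀ c e, Cup s i.castSucc c e → IsOpenComp s (vertComp s i.castSucc c) := by
      intro c e hce
      rw [comp_neg_top (markers_of_cup hs hce).1]
      obtain ⟨y, hy, rfl | ⟨d, rfl, hd⟩⟩ := exists_passage_left hs i c.castSucc
      · rw [← horizComp_eq_of_passage hy]
        exact isOpenComp_left s i
      · rw [← horizComp_eq_of_passage hy]
        cases hsd : s i d with
        | false =>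
          rw [← comp_neg_bottom hsd]
          exact ih d
        | true =>
          rw [← comp_pos_top hsd]
          refine isOpenComp_of_not_cup hs _ d (fun e he => ?_) hd
          simpa [hsd] using (markers_of_cup hs he).1
    by_cases h1 : ∃ e, Cup s i.castSucc c e
    · exact main c _ h1.choose_spec
    by_cases h2 : ∃ e, Cup s i.castSucc e c
    · obtain ⟨e, he⟩ := h2
      rw [← vertComp_eq_of_cup he]
      exact main e c he
    · exact isOpenComp_of_not_cup hs _ c (not_exists.1 h1) (not_exists.1 h2)

/-- Without reducible cups there are no closed components. -/
theorem closedCount_eq_zero {s : KauffmanState m n} (hs : ∀ i c e, ¬ Reducible s i c e) :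
    closedCount s = 0 := by
  have hopen : ∀ q : Component s, IsOpenComp s q := by
    rintro ⟨⟨i, c⟩ | ⟨i, x⟩⟩
    · exact isOpenComp_vertComp hs i c
    · rcases Fin.eq_zero_or_eq_succ x with rfl | ⟨d, rfl⟩
      · exact isOpenComp_left s i
      · change IsOpenComp s (horizComp s i d.succ)
        cases hsd : s i d with
        | false =>
          rw [← comp_neg_bottom hsd]
          exact isOpenComp_vertComp hs _ d
        | true =>
          rw [← comp_pos_top hsd]
          exact isOpenComp_vertComp hs _ d
  have : IsEmpty {c : Component s // ∀ x : BoundaryPoint m n n, componentAt s x ≠ c} :=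
    ⟨fun ⟨q, hq⟩ => (hopen q).elim hq⟩
  exact Nat.card_of_isEmpty

/-! ### Cancellation of the states with reducible cups -/

/-- The state that agrees with `s` except that it has the markers `a` at `(i, c)` and `b` at
`(i, e)`. -/
def withMarkers (s : KauffmanState m n) (i : Fin m) (c e : Fin n) (a b : Bool) :
    KauffmanState m n :=
  fun k j => if k = i then (if j = c then a else if j = e then b else s k j) else s k j

theorem positiveCount_of_flip {s t : KauffmanState m n} {i : Fin m} {j : Fin n}
    (hs : s i j = false) (ht : t i j = true)
    (hst : ∀ k l, (k = i → l ≠ j) → s k l = t k l) : positiveCount t = positiveCount s + 1 := by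
  have hset : Finset.univ.filter (fun c : Fin m × Fin n => t c.1 c.2 = true) =
      insert (i, j) (Finset.univ.filter fun c : Fin m × Fin n => s c.1 c.2 = true) := by
    ext ⟨k, l⟩
    by_cases h : k = i → l ≠ j
    · have : (k, l) ≠ (i, j) := fun h' => by
        simp only [Prod.mk.injEq] at h'
        exact h h'.1 h'.2
      simp [hst k l h, this]
    · push Not at h
      obtain ⟨rfl, rfl⟩ := h
      simp [ht]
  rw [positiveCount, hset, Finset.card_insert_of_notMem (by simp [hs]), positiveCount]

theorem negativeCount_of_flip {s t : KauffmanState m n} {i : Fin m} {j : Fin n}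
    (hs : s i j = false) (ht : t i j = true)
    (hst : ∀ k l, (k = i → l ≠ j) → s k l = t k l) : negativeCount s = negativeCount t + 1 := by
  have hset : Finset.univ.filter (fun c : Fin m × Fin n => s c.1 c.2 = false) =
      insert (i, j) (Finset.univ.filter fun c : Fin m × Fin n => t c.1 c.2 = false) := by
    ext ⟨k, l⟩
    by_cases h : k = i → l ≠ j
    · have : (k, l) ≠ (i, j) := fun h' => by
        simp only [Prod.mk.injEq] at h'
        exact h h'.1 h'.2
      simp [hst k l h, this]
    · push Not at h
      obtain ⟨rfl, rfl⟩ := h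
      simp [hs]
  rw [negativeCount, hset, Finset.card_insert_of_notMem (by simp [ht]), negativeCount]

open LaurentPolynomial

/-- The contribution `A^(p(s) - n(s)) (-A^2 - A^(-2))^|D_s|` of a Kauffman state. -/
noncomputable def weight (s : KauffmanState m n) : LaurentPolynomial ℤ :=
  T ((positiveCount s : ℤ) - (negativeCount s : ℤ)) * (-T 2 - T (-2)) ^ closedCount s

/-- The three ways for a cup to get stuck at row `i` give the same Catalan state, and their
contributions cancel. -/
theorem realizes_and_weight_of_reducible {s : KauffmanState m n} {i : Fin m} {c e : Fin n}
    (h : Reducible s i c e) (hc : s i c = true) (he : s i e = false) (C : CatalanState m n) :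
    (Realizes (withMarkers s i c e true true) C ↔ Realizes s C) ∧
    (Realizes (withMarkers s i c e false false) C ↔ Realizes s C) ∧
    weight s + weight (withMarkers s i c e true true) +
      weight (withMarkers s i c e false false) = 0 := by
  have hne : c ≠ e := (cup_lt h.1).ne
  set t := withMarkers s i c e true true with ht
  set t' := withMarkers s i c e false false with ht'
  have tc : t i c = true := by simp [ht, withMarkers]
  have te : t i e = true := by simp [ht, withMarkers]
  have tc' : t' i c = false := by simp [ht', withMarkers]
  have te' : t' i e = false := by simp [ht', withMarkers]
  have hst : ∀ k j, (k = i → j ≠ e) → s k j = t k j := by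
    intro k j hk
    simp only [ht, withMarkers]
    grind
  have hst' : ∀ k j, (k = i → j ≠ c) → s k j = t' k j := by
    intro k j hk
    simp only [ht', withMarkers]
    grind
  have hr : Reducible t i c e := by
    rw [← reducible_congr h.1 h.2.2 (by simp [tc]) (fun k j hk => hst k j fun h => (hk h).2) le_rfl]
    exact h
  have hr' : Reducible t' i c e := by
    rw [← reducible_congr h.1 h.2.2 (by simp [te']) (fun k j hk => hst' k j fun h => (hk h).1)
      le_rfl]
    exact h
  obtain ⟨hcomp, hcl⟩ := merge_right h.1 h.2.1 hr.1 hr.2.1 hc he te hst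
  obtain ⟨hcomp', hcl'⟩ := merge_left h.1 h.2.1 hr'.1 hr'.2.1 hc he tc' hst'
  refine ⟨?_, ?_, ?_⟩
  · simp only [Realizes, hcomp]
  · simp only [Realizes, hcomp']
  · have p1 := positiveCount_of_flip he te hst
    have n1 := negativeCount_of_flip he te hst
    have p2 := positiveCount_of_flip tc' hc fun k l hk => (hst' k l hk).symm
    have n2 := negativeCount_of_flip tc' hc fun k l hk => (hst' k l hk).symm
    have hcl2 : closedCount t' = closedCount t := by omega
    have e1 : (positiveCount t : ℤ) - negativeCount t =
        ((positiveCount s : ℤ) - negativeCount s) + 2 := by omega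
    have e2 : (positiveCount t' : ℤ) - negativeCount t' =
        ((positiveCount s : ℤ) - negativeCount s) + (-2) := by omega
    rw [weight, weight, weight, e1, e2, hcl2, hcl, T_add, T_add]
    ring

theorem withMarkers_left (s : KauffmanState m n) (i : Fin m) (c e : Fin n) (a b : Bool) :
    withMarkers s i c e a b i c = a := by simp [withMarkers]

theorem withMarkers_right (s : KauffmanState m n) (i : Fin m) {c e : Fin n} (h : c ≠ e)
    (a b : Bool) : withMarkers s i c e a b i e = b := by simp [withMarkers, h.symm]

theorem withMarkers_withMarkers (s : KauffmanState m n) (i : Fin m) (c e : Fin n)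
    (a b a' b' : Bool) :
    withMarkers (withMarkers s i c e a b) i c e a' b' = withMarkers s i c e a' b' := by
  ext k j
  simp only [withMarkers]
  grind

theorem withMarkers_eq_self (s : KauffmanState m n) (i : Fin m) (c e : Fin n) :
    withMarkers s i c e (s i c) (s i e) = s := by
  ext k j
  simp only [withMarkers]
  grind

theorem firstReducible_withMarkers {s : KauffmanState m n} {i : Fin m} {c e : Fin n}
    (h : FirstReducible s (i, c, e)) {a b : Bool} (hab : ¬ (a = false ∧ b = true)) :
    FirstReducible (withMarkers s i c e a b) = FirstReducible s := by
  refine (firstReducible_congr h ?_ fun k j hk => ?_).symm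
  · rwa [withMarkers_left, withMarkers_right _ _ (cup_lt h.1.1).ne]
  · simp only [withMarkers]
    grind

open scoped Classical in
/-- In the sum that defines the coefficient of `C`, the states with reducible cups cancel. -/
theorem sum_weight_reducible (C : CatalanState m n) :
    ∑ s : KauffmanState m n with Realizes s C ∧ ∃ i c e, Reducible s i c e, weight s = 0 := by
  rcases isEmpty_or_nonempty (Fin m × Fin n × Fin n) with hE | hN
  · refine Finset.sum_eq_zero fun s hs => ?_
    obtain ⟨i, c, e, -⟩ := (Finset.mem_filter.1 hs).2.2
    exact hE.elim (i, c, e)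
  -- The chosen cup depends on `s` only through the predicate `FirstReducible s`, so it is the same
  -- for the three states that differ by how this cup gets stuck.
  let key : KauffmanState m n → Fin m × Fin n × Fin n :=
    fun s => Classical.epsilon (FirstReducible s)
  let rep : KauffmanState m n → KauffmanState m n :=
    fun s => withMarkers s (key s).1 (key s).2.1 (key s).2.2 true false
  have hkey : ∀ s, (∃ i c e, Reducible s i c e) → FirstReducible s (key s) := fun s hs =>
    Classical.epsilon_spec (exists_firstReducible hs)
  rw [← Finset.sum_fiberwise_of_maps_to (t := Finset.univ) (g := rep) (by simp)]
  refine Finset.sum_eq_zero fun r _ => ?_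
  by_cases hr : ∃ s, (Realizes s C ∧ ∃ i c e, Reducible s i c e) ∧ rep s = r
  swap
  · rw [Finset.filter_filter, Finset.filter_false_of_mem, Finset.sum_empty]
    exact fun s _ hs => hr ⟨s, hs⟩
  obtain ⟨s₀, ⟨hC₀, hred₀⟩, hrep₀⟩ := hr
  -- A state in the fibre over `r` has the same cup as `r` and arises from `r` by new markers.
  have hfib : ∀ s, (∃ i c e, Reducible s i c e) → rep s = r → FirstReducible s = FirstReducible r ∧
      s = withMarkers r (key r).1 (key r).2.1 (key r).2.2
        (s (key r).1 (key r).2.1) (s (key r).1 (key r).2.2) := by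
    rintro s hs rfl
    have hF : FirstReducible s = FirstReducible (rep s) :=
      (firstReducible_withMarkers (hkey s hs) (by simp)).symm
    have hk : key (rep s) = key s := by simp only [key, hF]
    refine ⟨hF, ?_⟩
    rw [hk]
    simp only [rep]
    rw [withMarkers_withMarkers, withMarkers_eq_self]
  have hr : FirstReducible r (key r) := by
    have hF := (hfib s₀ hred₀ hrep₀).1
    have hk : key r = key s₀ := by simp only [key, hF]
    rw [hk, ← hF]
    exact hkey s₀ hred₀
  have hkr : key s₀ = key r := by simp only [key, (hfib s₀ hred₀ hrep₀).1]
  obtain ⟨⟨i, c, e⟩, hp⟩ : ∃ p, key r = p := ⟨_, rfl⟩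
  rw [hp] at hr hkr
  have hne : c ≠ e := (cup_lt hr.1.1).ne
  have hrc : r i c = true := by
    rw [← hrep₀]
    simp only [rep, hkr]
    exact withMarkers_left _ _ _ _ _ _
  have hre : r i e = false := by
    rw [← hrep₀]
    simp only [rep, hkr]
    exact withMarkers_right _ _ hne _ _
  obtain ⟨hC1, hC2, hsum⟩ := realizes_and_weight_of_reducible hr.1 hrc hre C
  have hself : withMarkers r i c e true false = r := by
    have := withMarkers_eq_self r i c e
    rwa [hrc, hre] at this
  -- The fibre consists of the three ways to get stuck.
  have hmem : ∀ s, (∃ i c e, Reducible s i c e) → rep s = r →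
      s = r ∨ s = withMarkers r i c e true true ∨ s = withMarkers r i c e false false := by
    intro s hs hrs
    obtain ⟨hF, hs'⟩ := hfib s hs hrs
    have hbad := (hF ▸ hr : FirstReducible s (i, c, e)).1.2.2
    rw [hp] at hs'
    simp only at hs' hbad
    cases h1 : s i c <;> cases h2 : s i e <;> rw [h1, h2] at hs'
    · exact .inr (.inr hs')
    · exact (hbad ⟨h1, h2⟩).elim
    · exact .inl (hs'.trans hself)
    · exact .inr (.inl hs')
  have hCr : Realizes r C := by
    rcases hmem s₀ hred₀ hrep₀ with h | h | h
    · exact h ▸ hC₀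
    · exact hC1.1 (h ▸ hC₀)
    · exact hC2.1 (h ▸ hC₀)
  have hback : ∀ a b, ¬ (a = false ∧ b = true) →
      (∃ i' c' e', Reducible (withMarkers r i c e a b) i' c' e') ∧
        rep (withMarkers r i c e a b) = r := by
    intro a b hab
    have hF := firstReducible_withMarkers hr hab
    refine ⟨⟨i, c, e, (hF ▸ hr : FirstReducible (withMarkers r i c e a b) (i, c, e)).1⟩, ?_⟩
    have hk : key (withMarkers r i c e a b) = (i, c, e) := by
      rw [← hp]
      simp only [key, hF]
    simp only [rep, hk]
    rw [withMarkers_withMarkers, hself]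
  have hset : Finset.filter (fun s => rep s = r) (Finset.filter (fun s : KauffmanState m n =>
      Realizes s C ∧ ∃ i c e, Reducible s i c e) Finset.univ) =
      {r, withMarkers r i c e true true, withMarkers r i c e false false} := by
    ext s
    simp only [Finset.mem_filter, Finset.mem_univ, true_and, Finset.mem_insert,
      Finset.mem_singleton]
    constructor
    · rintro ⟨⟨-, hs⟩, hrs⟩
      exact hmem s hs hrs
    · rintro (rfl | rfl | rfl)
      · have := hback true false (by simp)
        rw [hself] at this
        exact ⟨⟨hCr, this.1⟩, this.2⟩
      · have := hback true true (by simp)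
        exact ⟨⟨hC1.2 hCr, this.1⟩, this.2⟩
      · have := hback false false (by simp)
        exact ⟨⟨hC2.2 hCr, this.1⟩, this.2⟩
  have d1 : r ≠ withMarkers r i c e true true := fun h => by
    have := withMarkers_right r i hne true true
    rw [← h, hre] at this
    simp at this
  have d2 : r ≠ withMarkers r i c e false false := fun h => by
    have := withMarkers_left r i c e false false
    rw [← h, hrc] at this
    simp at this
  have d3 : withMarkers r i c e true true ≠ withMarkers r i c e false false := fun h => by
    have := withMarkers_left r i c e false false
    rw [← h, withMarkers_left] at this
    simp at this
  rw [hset, Finset.sum_insert (by simp [d1, d2]), Finset.sum_insert (by simp [d3]),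
    Finset.sum_singleton, ← hsum, add_assoc]

open scoped Classical in
/-- The coefficient of `C` as a sum of monomials over the states without reducible cups. -/
theorem coefficient_eq_sum_irreducible (C : CatalanState m n) :
    C.coefficient = ∑ s : KauffmanState m n with Realizes s C ∧ ¬ ∃ i c e, Reducible s i c e,
      T ((positiveCount s : ℤ) - (negativeCount s : ℤ)) := by
  change ∑ s : KauffmanState m n with Realizes s C, weight s = _
  rw [← Finset.sum_filter_add_sum_filter_not _ (fun s => ∃ i c e, Reducible s i c e),
    Finset.filter_filter, Finset.filter_filter, sum_weight_reducible, zero_add]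
  refine Finset.sum_congr rfl fun s hs => ?_
  have hirr := (Finset.mem_filter.1 hs).2.2
  rw [weight, closedCount_eq_zero fun i c e h => hirr ⟨i, c, e, h⟩, pow_zero, mul_one]

end LatticeCrossing

theorem corollary3p6 (m n : ℕ) (C : LatticeCrossing.CatalanState m n) (k : ℤ) :
    0 ≤ C.coefficient.coeff k := by
  classical
  rw [LatticeCrossing.coefficient_eq_sum_irreducible, AddMonoidAlgebra.coeff_sum,
    Finsupp.finsetSum_apply]
  refine Finset.sum_nonneg fun s _ => ?_
  rw [LaurentPolynomial.T_apply]
  split_ifs <;> simp
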